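/- Let $n, p, k \ge 1$ be integers, let $\Sigma \in \mathbb{R}^{p\times p}$ be a non-zero symmetric positive semidefinite matrix, $\sigma > 0$, $\delta > 0$ and $\alpha \in (0,1)$. For $\beta \in \mathbb{R}^p$ let $\mathbb{P}_\beta$ (with expectation $\mathbb{E}_\beta$) be the law of the data $(\mathbf{X}, Y)$ consisting of $n$ i.i.d. observations from $Y_i = X_i^\top \beta + \varepsilon_i$, where $X_i \sim N(0,\Sigma)$ and $\varepsilon_i \sim N(0,\sigma^2)$ are independent. Let $K = \{\sum_{i=1}^k a_i w_i : a_i \ge 0\} \subset \mathbb{R}^p$ be the polyhedral cone generated by unit vectors $w_1, \dots, w_k$. For $v \in K$ let $\mathcal{T}_K(v) = \{t(u - v) : t \ge 0,\ u \in K\}$ be the tangent cone of $K$ at $v$, and let $\overline{w}(v) \in \mathbb{R}$ be any fixed upper bound of its Gaussian complexity, i.e. $$\mathbb{E}_{g \sim N(0, I_p)} \sup_{x \in \mathcal{T}_K(v) \cap \mathbb{S}^{p-1}} \langle g, x\rangle \le \overline{w}(v) \qquad (v \in K).$$ For $R \in \mathbb{R}$ put $$\mathcal{H}(R) = \Big\{\beta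 \in K : \text{there is } v \in K \text{ with } \|\beta - v\|^2 \le \tfrac{R}{\sqrt n} \text{ and } \overline{w}(v)^2 \le R\sqrt n\Big\}.$$ For $\gamma \in \mathbb{R}^p$ and $\Theta \subseteq \mathbb{R}^p$ let $\mathcal{I}_\alpha(\gamma, \Theta)$ be the set of all intervals $[l(\mathbf{X},Y), u(\mathbf{X},Y)]$ with measurable endpoints such that $\inf_{\beta \in \Theta} \mathbb{P}_\beta\big(l(\mathbf{X},Y) \le \gamma^\top\beta \le u(\mathbf{X},Y)\big) \ge 1 - \alpha$. Fix $j \in \{1,\dots,k\}$ and $R_n \in \mathbb{R}$, and set $$\nu_n = 2R_n + \frac{2\,\delta^2\sigma^2\,\|\Sigma^{1/2}\|_{\mathrm{op}}^{-2}}{\sqrt n}.$$ Then for every $\beta^* \in \mathcal{H}(R_n)$ the expected length under $\beta^*$ satisfies $$\inf_{[l,u] \in \mathcal{I}_\alpha(w_j, \mathcal{H}(\nu_n))} \mathbb{E}_{\beta^*}\big[(u(\mathbf{X},Y) - l(\mathbf{X},Y))_+\big] \ \ge\ \delta\Big(1 - 2\alpha - \sqrt{\exp(2\delta^2) - 1}\Big)\frac{\sigma\,\|\Sigma^{1/2}\|_{\mathrm{op}}^{-1}}{\sqrt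 n}.$$ -/

import Mathlib

open MeasureTheory ProbabilityTheory
open scoped MatrixOrder ENNReal

noncomputable section

namespace ConeCI

/-- `ℝ^p` with the Euclidean norm. -/
abbrev Vec (p : ℕ) : Type := EuclideanSpace ℝ (Fin p)

/-- The finitely generated cone `{∑ i, a i • w i : a i ≥ 0}`. -/
def coneGeneratedBy {p k : ℕ} (w : Fin k → Vec p) : Set (Vec p) :=
  {x | ∃ a : Fin k → ℝ, (∀ i, 0 ≤ a i) ∧ x = ∑ i, a i • w i}

/-- The tangent cone `{t (v - x) : t ≥ 0, v ∈ K}` of `K` at `x`. -/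
def tangentCone {p : ℕ} (K : Set (Vec p)) (x : Vec p) : Set (Vec p) :=
  {u | ∃ t : ℝ, 0 ≤ t ∧ ∃ v ∈ K, u = t • (v - x)}

/-- The Gaussian complexity `E sup_{x ∈ T} ⟨g, x⟩`, `g ∼ N(0, I_p)`
(only used for bounded non-empty sets `T`). -/
def gaussianComplexity {p : ℕ} (T : Set (Vec p)) : ℝ :=
  ∫ g, ⨆ x : T, inner ℝ g (x : Vec p) ∂(stdGaussian (Vec p))

/-- `wbar v` is an upper bound of the Gaussian complexity of the tangent cone of `K` at `v`
intersected with the unit sphere, for every `v ∈ K`. -/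
def IsComplexityBound {p : ℕ} (K : Set (Vec p)) (wbar : Vec p → ℝ) : Prop :=
  ∀ v ∈ K, gaussianComplexity (tangentCone K v ∩ Metric.sphere 0 1) ≤ wbar v

/-- The parameter space `H(R)` at sample size `n`. -/
def paramSpace {p : ℕ} (K : Set (Vec p)) (wbar : Vec p → ℝ) (n : ℕ) (R : ℝ) : Set (Vec p) :=
  {β | β ∈ K ∧ ∃ v ∈ K, ‖β - v‖ ^ 2 ≤ R / √(n : ℝ) ∧ wbar v ^ 2 ≤ R * √(n : ℝ)}

/-- A data set `(X, Y)` of `n` observations: the rows `X i ∈ ℝ^p` and the responses `Y i`. -/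
abbrev Data (n p : ℕ) : Type := (Fin n → Vec p) × (Fin n → ℝ)

/-- The law `P_β` of the data in the linear model `Y i = ⟨X i, β⟩ + ε i`, where
`X i ∼ N(0, S)` and `ε i ∼ N(0, σ²)` are all independent. -/
def dataLaw (n : ℕ) {p : ℕ} (S : Matrix (Fin p) (Fin p) ℝ) (σ : ℝ) (β : Vec p) :
    Measure (Data n p) :=
  ((Measure.pi fun _ : Fin n => multivariateGaussian (0 : Vec p) S).prod
      (Measure.pi fun _ : Fin n => gaussianReal 0 (σ ^ 2).toNNReal)).map
    fun z => (z.1, fun i => inner ℝ (z.1 i) β + z.2 i)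

/-- The intervals `[l(X,Y), u(X,Y)]`, given as pairs `(l, u)` of measurable functions of the
data, that cover `⟨γ, β⟩` with `P_β`-probability at least `1 - α` uniformly over `β ∈ Θ`. -/
def confidenceIntervals (n : ℕ) {p : ℕ} (S : Matrix (Fin p) (Fin p) ℝ) (σ α : ℝ)
    (γ : Vec p) (Θ : Set (Vec p)) : Set ((Data n p → ℝ) × (Data n p → ℝ)) :=
  {c | Measurable c.1 ∧ Measurable c.2 ∧
    ENNReal.ofReal (1 - α) ≤
      ⨅ β ∈ Θ, dataLaw n S σ β {z | c.1 z ≤ inner ℝ γ β ∧ inner ℝ γ β ≤ c.2 z}}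

/-- The expected length under `P_β` of the interval `[l, u]`, with `c = (l, u)`;
possibly infinite. An empty interval has length `0`. -/
def expectedLength (n : ℕ) {p : ℕ} (S : Matrix (Fin p) (Fin p) ℝ) (σ : ℝ) (β : Vec p)
    (c : (Data n p → ℝ) × (Data n p → ℝ)) : ℝ≥0∞ :=
  ∫⁻ z, ENNReal.ofReal (c.2 z - c.1 z) ∂(dataLaw n S σ β)

/-- `‖S^{1/2}‖_op`, the Euclidean operator norm of the positive semidefinite square root. -/
def sqrtOpNorm {p : ℕ} (S : Matrix (Fin p) (Fin p) ℝ) : ℝ :=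
  ‖Matrix.toEuclideanCLM (𝕜 := ℝ) (CFC.sqrt S)‖

end ConeCI

end

/-! Two-point argument. For `t = δ σ / (‖S^{1/2}‖ √n)`, both `βstar` and `βstar + t • w j` lie in
the enlarged parameter space, and their values of `⟨w j, ·⟩` differ by exactly `t`. An interval
covering both values has length at least `t`, so it remains to bound from below the
`βstar`-probability that both are covered. Given the design, the two laws of `Y` are shifted
Gaussians (`pi_gaussianReal_le_shift_add`). Averaging over the design shows that event probabilities
change by at most `δ + δ²/2` (`dataLaw_add_le`). This is at most `√(exp(2δ²) - 1)` when that root is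
below 1 (`add_sq_half_le_sqrt_exp`); otherwise the claimed bound is nonpositive. -/

namespace ConeCI

/-! ### Shifted Gaussian noise with a fixed design. -/

open Finset in
/-- A product of measures with densities has the product density. -/
theorem pi_withDensity_eq {ι : Type*} [Fintype ι] {E : ι → Type*}
    [∀ i, MeasurableSpace (E i)] (μ : ∀ i, Measure (E i)) [∀ i, IsProbabilityMeasure (μ i)]
    (f : ∀ i, E i → ℝ≥0∞) (hf : ∀ i, Measurable (f i))
    [∀ i, SigmaFinite ((μ i).withDensity (f i))] :
    Measure.pi (fun i => (μ i).withDensity (f i)) =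
      (Measure.pi μ).withDensity fun x => ∏ i, f i (x i) := by
  refine Measure.pi_eq fun s hs => ?_
  rw [withDensity_apply _ (MeasurableSet.univ_pi hs), ← lintegral_indicator
    (MeasurableSet.univ_pi hs)]
  have hind : (Set.univ.pi s).indicator (fun x : ∀ i, E i => ∏ i, f i (x i)) =
      fun x => ∏ i, (s i).indicator (f i) (x i) := by
    classical
    ext x
    by_cases hx : x ∈ Set.univ.pi s
    · rw [Set.indicator_of_mem hx]
      exact prod_congr rfl fun i _ => (Set.indicator_of_mem (hx i (Set.mem_univ i)) _).symm
    · rw [Set.indicator_of_notMem hx]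
      simp only [Set.mem_univ_pi, not_forall] at hx
      obtain ⟨i, hi⟩ := hx
      exact (prod_eq_zero (mem_univ i) (Set.indicator_of_notMem hi _)).symm
  have hm : ∀ i, Measurable ((s i).indicator (f i)) := fun i => (hf i).indicator (hs i)
  -- Functions of distinct coordinates are independent, so the integral of the product factorizes.
  rw [hind, lintegral_prod_eq_prod_lintegral_of_indepFun univ
    (fun i (x : ∀ i, E i) => (s i).indicator (f i) (x i))
    (iIndepFun_pi fun i => (hm i).aemeasurable)
    (fun i => (hm i).comp (measurable_pi_apply i))]
  refine prod_congr rfl fun i _ => ?_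
  rw [(measurePreserving_eval μ i).lintegral_comp (hm i), lintegral_indicator (hs i),
    withDensity_apply _ (hs i)]

/-- The density of a shifted centred Gaussian with respect to the unshifted one. -/
theorem gaussianReal_neg_eq_withDensity (m : ℝ) {v : NNReal} (hv : v ≠ 0) :
    gaussianReal (-m) v = (gaussianReal 0 v).withDensity
      fun y => ENNReal.ofReal (Real.exp (-(m * y / v) - m ^ 2 / (2 * v))) := by
  rw [gaussianReal_of_var_ne_zero _ hv, gaussianReal_of_var_ne_zero _ hv,
    ← withDensity_mul _ (by fun_prop) (by fun_prop)]
  congr 1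
  ext y
  have hv' : (v : ℝ) ≠ 0 := by exact_mod_cast hv
  simp only [Pi.mul_apply, gaussianPDF]
  rw [← ENNReal.ofReal_mul (gaussianPDFReal_nonneg _ _ _)]
  congr 1
  simp only [gaussianPDFReal]
  rw [mul_assoc (√_)⁻¹, ← Real.exp_add]
  congr 2
  field_simp
  ring

theorem pi_gaussianReal_neg_eq_withDensity {n : ℕ} (m : Fin n → ℝ) {v : NNReal} (hv : v ≠ 0) :
    Measure.pi (fun i => gaussianReal (-m i) v) =
      (Measure.pi fun _ : Fin n => gaussianReal 0 v).withDensity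
        fun y => ENNReal.ofReal
          (Real.exp (-(∑ i, m i * y i / v) - (∑ i, m i ^ 2) / (2 * v))) := by
  have h : ∀ i, gaussianReal (-m i) v = (gaussianReal 0 v).withDensity
      fun y => ENNReal.ofReal (Real.exp (-(m i * y / v) - m i ^ 2 / (2 * v))) :=
    fun i => gaussianReal_neg_eq_withDensity (m i) hv
  have : ∀ i, SigmaFinite ((gaussianReal 0 v).withDensity
      fun y => ENNReal.ofReal (Real.exp (-(m i * y / v) - m i ^ 2 / (2 * v)))) := fun i => by
    rw [← h i]; infer_instance
  simp_rw [h]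
  rw [pi_withDensity_eq _ _ fun i => by fun_prop]
  congr 1
  ext y
  rw [← ENNReal.ofReal_prod_of_nonneg fun i _ => (Real.exp_pos _).le, ← Real.exp_sum,
    Finset.sum_sub_distrib, Finset.sum_neg_distrib, Finset.sum_div]

theorem map_sub_pi_gaussianReal {n : ℕ} (m : Fin n → ℝ) (v : NNReal) :
    (Measure.pi fun _ : Fin n => gaussianReal 0 v).map (fun y i => y i - m i) =
      Measure.pi fun i => gaussianReal (-m i) v := by
  have h : ∀ i, (gaussianReal 0 v).map (fun y => y - m i) = gaussianReal (-m i) v := fun i => by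
    rw [gaussianReal_map_sub_const, zero_sub]
  have : ∀ i, SigmaFinite ((gaussianReal 0 v).map (fun y => y - m i)) := fun i => by
    rw [h i]; infer_instance
  simp_rw [← h]
  exact Measure.pi_map_pi (μ := fun _ : Fin n => gaussianReal 0 v) (f := fun i (y : ℝ) => y - m i)
    fun i => by fun_prop

theorem memLp_sum_mul_pi_gaussianReal {n : ℕ} (b : Fin n → ℝ) (v : NNReal) :
    MemLp (fun y : Fin n → ℝ => ∑ i, b i * y i) 2
      (Measure.pi fun _ : Fin n => gaussianReal 0 v) :=
  memLp_finsetSum _ fun i _ =>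
    ((memLp_id_gaussianReal' 2 (by simp)).comp_measurePreserving
      (measurePreserving_eval (fun _ : Fin n => gaussianReal 0 v) i)).const_mul (b i)

theorem integral_sq_sum_mul_pi_gaussianReal {n : ℕ} (b : Fin n → ℝ) (v : NNReal) :
    ∫ y, (∑ i, b i * y i) ^ 2 ∂(Measure.pi fun _ : Fin n => gaussianReal 0 v) =
      (∑ i, b i ^ 2) * v := by
  have hmean : ∫ y, ∑ i, b i * y i ∂(Measure.pi fun _ : Fin n => gaussianReal 0 v) = 0 := by
    rw [integral_finsetSum]
    · refine Finset.sum_eq_zero fun i _ => ?_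
      rw [integral_const_mul]
      have hmp := measurePreserving_eval (fun _ : Fin n => gaussianReal 0 v) i
      have h := integral_map (μ := Measure.pi fun _ : Fin n => gaussianReal 0 v)
        (f := fun y : ℝ => y) hmp.measurable.aemeasurable (by fun_prop)
      rw [hmp.map_eq, integral_id_gaussianReal] at h
      exact mul_eq_zero_of_right _ h.symm
    · exact fun i _ => (((memLp_id_gaussianReal' 2 (by simp)).comp_measurePreserving
        (measurePreserving_eval (fun _ : Fin n => gaussianReal 0 v) i)).const_mul
          (b i)).integrable (by norm_num)
  rw [← variance_of_integral_eq_zero (memLp_sum_mul_pi_gaussianReal b v).aemeasurable hmean]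
  have hfun : (fun y : Fin n → ℝ => ∑ i, b i * y i) = ∑ i, fun y : Fin n → ℝ => b i * y i := by
    ext y; simp
  rw [hfun, variance_sum_pi (X := fun i (y : ℝ) => b i * y)
    fun i => (memLp_id_gaussianReal' 2 (by simp)).const_mul (b i)]
  rw [Finset.sum_mul]
  exact Finset.sum_congr rfl fun i _ => by rw [variance_const_mul, variance_fun_id_gaussianReal]

/-- Shifting a product of centred Gaussians by `m` changes probabilities by at most a bound
that depends only on `‖m‖²/v`. -/
theorem pi_gaussianReal_le_shift_add {n : ℕ} (m : Fin n → ℝ) {v : NNReal} (hv : v ≠ 0)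
    {c : ℝ} (hc : 0 < c) {A : Set (Fin n → ℝ)} (hA : MeasurableSet A) :
    (Measure.pi fun _ : Fin n => gaussianReal 0 v) A ≤
      (Measure.pi fun _ : Fin n => gaussianReal 0 v) ((fun y i => y i - m i) ⁻¹' A) +
        ENNReal.ofReal (c / 2 + (∑ i, m i ^ 2) / v * (1 / 2 + 1 / (2 * c))) := by
  set G := Measure.pi fun _ : Fin n => gaussianReal 0 v with hG
  have hv' : (v : ℝ) ≠ 0 := by exact_mod_cast hv
  have hvpos : (0 : ℝ) < v := by positivity
  set a : ℝ := (∑ i, m i ^ 2) / v with ha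
  have ha0 : 0 ≤ a := by positivity
  set N : (Fin n → ℝ) → ℝ := fun y => ∑ i, m i / v * y i with hN
  have hNm : MemLp N 2 G := memLp_sum_mul_pi_gaussianReal (fun i => m i / v) v
  have hN2 : ∫ y, N y ^ 2 ∂G = a := by
    rw [hN, integral_sq_sum_mul_pi_gaussianReal, ha]
    simp_rw [div_pow]
    rw [← Finset.sum_div]
    field_simp
  -- `T` dominates one minus the likelihood ratio: `1 - exp(-N - a/2) ≤ N + a/2` and `N ≤ c/2 +
  -- N²/(2c)`. Since `N` has variance `a`, its mean is affine in `a`, which permits averaging over a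
  -- random design.
  set T : (Fin n → ℝ) → ℝ := fun y => a / 2 + (c / 2 + 1 / (2 * c) * N y ^ 2) with hT
  have hTint' : Integrable (fun y => c / 2 + 1 / (2 * c) * N y ^ 2) G :=
    (integrable_const _).add (hNm.integrable_sq.const_mul _)
  have hTint : Integrable T G := (integrable_const _).add hTint'
  have hT0 : ∀ y, 0 ≤ T y := fun y => by positivity
  have hTI : ∫ y, T y ∂G = c / 2 + a * (1 / 2 + 1 / (2 * c)) := by
    rw [integral_add (integrable_const _) hTint',
      integral_add (integrable_const _) (hNm.integrable_sq.const_mul _), integral_const_mul, hN2]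
    simp only [integral_const, probReal_univ, one_smul]
    ring
  have hshift : G ((fun y i => y i - m i) ⁻¹' A) =
      ∫⁻ y in A, ENNReal.ofReal (Real.exp (-N y - a / 2)) ∂G := by
    rw [← Measure.map_apply (by fun_prop) hA, hG, map_sub_pi_gaussianReal,
      pi_gaussianReal_neg_eq_withDensity m hv, withDensity_apply _ hA]
    refine lintegral_congr fun y => ?_
    congr 3
    · simp only [hN]
      congr 1
      exact Finset.sum_congr rfl fun i _ => by ring
    · rw [ha]; field_simp
  have hpt : ∀ y, (1 : ℝ≥0∞) ≤
      ENNReal.ofReal (Real.exp (-N y - a / 2)) + ENNReal.ofReal (T y) := fun y => by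
    rw [← ENNReal.ofReal_add (Real.exp_pos _).le (hT0 y), ENNReal.one_le_ofReal]
    have h1 := Real.add_one_le_exp (-N y - a / 2)
    have h2 : N y ≤ c / 2 + 1 / (2 * c) * N y ^ 2 := by
      have : c / 2 + 1 / (2 * c) * N y ^ 2 - N y = (N y - c) ^ 2 / (2 * c) := by
        field_simp; ring
      have h3 : 0 ≤ (N y - c) ^ 2 / (2 * c) := by positivity
      linarith
    simp only [hT]
    linarith
  calc G A = ∫⁻ _ in A, 1 ∂G := by simp
    _ ≤ ∫⁻ y in A, (ENNReal.ofReal (Real.exp (-N y - a / 2)) + ENNReal.ofReal (T y)) ∂G :=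
        lintegral_mono hpt
    _ = ∫⁻ y in A, ENNReal.ofReal (Real.exp (-N y - a / 2)) ∂G +
          ∫⁻ y in A, ENNReal.ofReal (T y) ∂G := lintegral_add_left (by fun_prop) _
    _ ≤ G ((fun y i => y i - m i) ⁻¹' A) + ∫⁻ y, ENNReal.ofReal (T y) ∂G := by
        rw [hshift]; gcongr; exact Measure.restrict_le_self
    _ = _ := by
        rw [← ofReal_integral_eq_lintegral_ofReal hTint (Filter.Eventually.of_forall hT0), hTI]

/-! ### Averaging over the Gaussian design. -/

theorem memLp_inner_multivariateGaussian {p : ℕ} (S : Matrix (Fin p) (Fin p) ℝ) (d : Vec p) :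
    MemLp (fun x => inner ℝ x d) 2 (multivariateGaussian (0 : Vec p) S) :=
  (IsGaussian.memLp_two_id (μ := multivariateGaussian (0 : Vec p) S)).inner_const d

/-- The law is the image of a standard Gaussian under the self-adjoint root, so the second moment
equals the squared norm of the root applied to `d`. -/
theorem integral_inner_sq_multivariateGaussian_le {p : ℕ} (S : Matrix (Fin p) (Fin p) ℝ)
    (d : Vec p) :
    ∫ x, inner ℝ x d ^ 2 ∂(multivariateGaussian (0 : Vec p) S) ≤
      (sqrtOpNorm S * ‖d‖) ^ 2 := by
  have hsa : IsSelfAdjoint (Matrix.toEuclideanCLM (𝕜 := ℝ) (CFC.sqrt S)) :=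
    (CFC.sqrt_nonneg S).isSelfAdjoint.map _
  set L := Matrix.toEuclideanCLM (𝕜 := ℝ) (CFC.sqrt S) with hL
  have h1 : ∫ x, inner ℝ x d ^ 2 ∂(multivariateGaussian (0 : Vec p) S) =
      ∫ x, inner ℝ (L d) x * inner ℝ (L d) x ∂(stdGaussian (Vec p)) := by
    rw [multivariateGaussian, integral_map (by fun_prop) (by fun_prop)]
    refine integral_congr_ae (Filter.Eventually.of_forall fun x => ?_)
    simp only [zero_add, ← hL]
    rw [sq, ← ContinuousLinearMap.adjoint_inner_right, hsa.adjoint_eq, real_inner_comm]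
  have h2 := covarianceBilin_apply (μ := stdGaussian (Vec p)) IsGaussian.memLp_two_id (L d) (L d)
  simp only [id_eq, integral_id_stdGaussian, sub_zero, covarianceBilin_stdGaussian] at h2
  rw [h1, ← h2]
  have h3 : ‖L d‖ ≤ sqrtOpNorm S * ‖d‖ := L.le_opNorm d
  rw [innerSL_apply_apply, real_inner_self_eq_norm_sq]
  gcongr

theorem dataLaw_apply {n p : ℕ} (S : Matrix (Fin p) (Fin p) ℝ) (σ : ℝ) (β : Vec p)
    {A : Set (Data n p)} (hA : MeasurableSet A) :
    dataLaw n S σ β A =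
      ∫⁻ x, (Measure.pi fun _ : Fin n => gaussianReal 0 (σ ^ 2).toNNReal)
        {e | (x, fun i => inner ℝ (x i) β + e i) ∈ A}
        ∂(Measure.pi fun _ : Fin n => multivariateGaussian (0 : Vec p) S) := by
  have hm : Measurable fun z : Data n p => (z.1, fun i => inner ℝ (z.1 i) β + z.2 i) := by
    fun_prop
  rw [dataLaw, Measure.map_apply hm hA, Measure.prod_apply (hm hA)]
  rfl

instance isProbabilityMeasure_dataLaw {n p : ℕ} (S : Matrix (Fin p) (Fin p) ℝ) (σ : ℝ)
    (β : Vec p) : IsProbabilityMeasure (dataLaw n S σ β) :=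
  Measure.isProbabilityMeasure_map (by fun_prop)

/-- The probabilities of an event under two parameters differ by at most `δ + δ² / 2`,
where `δ` bounds the signal-to-noise ratio of the difference of the parameters. -/
theorem dataLaw_add_le {n p : ℕ} (S : Matrix (Fin p) (Fin p) ℝ) {σ : ℝ} (hσ : 0 < σ)
    (β d : Vec p) {δ : ℝ} (hδ : 0 < δ) (hd : n * (sqrtOpNorm S * ‖d‖) ^ 2 ≤ δ ^ 2 * σ ^ 2)
    {A : Set (Data n p)} (hA : MeasurableSet A) :
    dataLaw n S σ (β + d) A ≤ dataLaw n S σ β A + ENNReal.ofReal (δ + δ ^ 2 / 2) := by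
  set v : NNReal := (σ ^ 2).toNNReal with hvdef
  have hvσ : (v : ℝ) = σ ^ 2 := Real.coe_toNNReal _ (by positivity)
  have hv : v ≠ 0 := by
    intro h
    rw [h] at hvσ
    exact (pow_pos hσ 2).ne hvσ
  set μ := Measure.pi fun _ : Fin n => multivariateGaussian (0 : Vec p) S with hμ
  -- The fixed-design bound with `c = δ`; as the mean of the ratio is at most `δ²`, the mean of `b`
  -- is at most `δ/2 + δ²/2 + δ/2`.
  set b : (Fin n → Vec p) → ℝ :=
    fun x => δ / 2 + (∑ i, inner ℝ (x i) d ^ 2) / v * (1 / 2 + 1 / (2 * δ)) with hb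
  have hint : ∀ i, Integrable (fun x : Fin n → Vec p => inner ℝ (x i) d ^ 2) μ := fun i =>
    ((memLp_inner_multivariateGaussian S d).comp_measurePreserving
      (measurePreserving_eval (fun _ : Fin n => multivariateGaussian (0 : Vec p) S)
        i)).integrable_sq
  have hbint : Integrable b μ :=
    (integrable_const _).add
      (((integrable_finsetSum _ fun i _ => hint i).div_const _).mul_const _)
  have hb0 : ∀ x, 0 ≤ b x := fun x => by positivity
  have hmom : ∫ x, ∑ i, inner ℝ (x i) d ^ 2 ∂μ ≤ n * (sqrtOpNorm S * ‖d‖) ^ 2 := by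
    rw [integral_finsetSum _ fun i _ => hint i]
    have : ∀ i, ∫ x, inner ℝ (x i) d ^ 2 ∂μ ≤ (sqrtOpNorm S * ‖d‖) ^ 2 := fun i => by
      refine le_of_eq_of_le ?_ (integral_inner_sq_multivariateGaussian_le S d)
      have hmp := measurePreserving_eval (fun _ : Fin n => multivariateGaussian (0 : Vec p) S) i
      rw [← hmp.map_eq, integral_map hmp.measurable.aemeasurable (by fun_prop)]
    exact (Finset.sum_le_sum fun i _ => this i).trans (by simp)
  have hbI : ∫ x, b x ∂μ ≤ δ + δ ^ 2 / 2 := by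
    rw [hb, integral_add (integrable_const _)
      (((integrable_finsetSum _ fun i _ => hint i).div_const _).mul_const _),
      integral_mul_const, integral_const, integral_div, hvσ]
    have h1 : (∫ x, ∑ i, inner ℝ (x i) d ^ 2 ∂μ) / σ ^ 2 ≤ δ ^ 2 := by
      rw [div_le_iff₀ (by positivity)]
      exact hmom.trans hd
    have h2 : δ ^ 2 * (1 / 2 + 1 / (2 * δ)) = δ ^ 2 / 2 + δ / 2 := by field_simp
    have h3 := mul_le_mul_of_nonneg_right h1 (show 0 ≤ 1 / 2 + 1 / (2 * δ) by positivity)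
    simp only [probReal_univ, one_smul]
    linarith
  rw [dataLaw_apply S σ _ hA, dataLaw_apply S σ _ hA]
  calc _ ≤ ∫⁻ x, ((Measure.pi fun _ : Fin n => gaussianReal 0 v)
        {e | (x, fun i => inner ℝ (x i) β + e i) ∈ A} + ENNReal.ofReal (b x)) ∂μ := by
        refine lintegral_mono fun x => ?_
        have hAx : MeasurableSet {e : Fin n → ℝ |
            (x, fun i => inner ℝ (x i) (β + d) + e i) ∈ A} :=
          hA.preimage (f := fun e : Fin n → ℝ => (x, fun i => inner ℝ (x i) (β + d) + e i))
            (by fun_prop)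
        -- For fixed `x`, changing `β + d` to `β` subtracts `⟨x i, d⟩` from the `i`-th noise
        -- coordinate.
        convert pi_gaussianReal_le_shift_add (fun i => inner ℝ (x i) d) hv hδ hAx using 4
        ext e
        simp only [Set.mem_ofPred_eq, Set.mem_preimage, inner_add_right]
        refine iff_of_eq ?_
        congr 2
        ext i
        ring
    _ = _ := lintegral_add_right _ (by fun_prop)
    _ ≤ _ := by
        rw [← ofReal_integral_eq_lintegral_ofReal hbint (Filter.Eventually.of_forall hb0)]
        gcongr

/-! ### The two parameters and the length inequality. -/

theorem add_smul_mem_coneGeneratedBy {p k : ℕ} {w : Fin k → Vec p} {x : Vec p}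
    (hx : x ∈ coneGeneratedBy w) (j : Fin k) {t : ℝ} (ht : 0 ≤ t) :
    x + t • w j ∈ coneGeneratedBy w := by
  classical
  obtain ⟨a, ha, rfl⟩ := hx
  refine ⟨fun i => a i + if i = j then t else 0, fun i => ?_, ?_⟩
  · have := ha i
    dsimp only
    split_ifs <;> linarith
  · simp [add_smul, Finset.sum_add_distrib, ite_smul]

/-- Moving a point of `H(R)` inside the cone by a vector of squared norm at most `r / √n`
leads to a point of `H(2R + 2r)`. -/
theorem mem_paramSpace_of_dist {p : ℕ} {K : Set (Vec p)} {wbar : Vec p → ℝ} {n : ℕ}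
    (hn : 1 ≤ n) {R r : ℝ} (hr : 0 ≤ r) {β d : Vec p} (hβ : β ∈ paramSpace K wbar n R)
    (hK : β + d ∈ K) (hd : ‖d‖ ^ 2 ≤ r / √(n : ℝ)) :
    β + d ∈ paramSpace K wbar n (2 * R + 2 * r) := by
  obtain ⟨-, v, hv, h1, h2⟩ := hβ
  have hs : 0 < √(n : ℝ) := Real.sqrt_pos.2 (by exact_mod_cast hn)
  refine ⟨hK, v, hv, ?_, ?_⟩
  · have h3 : ‖β + d - v‖ ≤ ‖β - v‖ + ‖d‖ := by
      rw [add_sub_right_comm]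
      exact norm_add_le _ _
    have h4 : ‖β + d - v‖ ^ 2 ≤ (‖β - v‖ + ‖d‖) ^ 2 := by gcongr
    have h5 : (2 * R + 2 * r) / √(n : ℝ) = 2 * (R / √(n : ℝ)) + 2 * (r / √(n : ℝ)) := by ring
    rw [h5]
    nlinarith [sq_nonneg (‖β - v‖ - ‖d‖)]
  -- The sign of `R` is not assumed: nonemptiness of `H(R)` forces it, and then doubling `R` only
  -- weakens the constraint.
  · have hR : 0 ≤ R * √(n : ℝ) := (sq_nonneg _).trans h2
    have := mul_nonneg hr hs.le
    nlinarith

theorem sqrtOpNorm_pos {p : ℕ} {S : Matrix (Fin p) (Fin p) ℝ} (hS : S.PosSemidef)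
    (hS0 : S ≠ 0) : 0 < sqrtOpNorm S := by
  refine norm_pos_iff.2 fun h => hS0 ?_
  have h' : CFC.sqrt S = 0 := by
    simpa using h
  rw [← CFC.sqrt_mul_sqrt_self S hS.nonneg, h', zero_mul]

/-- The hypothesis gives `2δ² < 1`, hence `δ < 3/4` and `(1 + δ/2)² < 2`; so the left side squared
is below `2δ² ≤ exp(2δ²) - 1`. -/
theorem add_sq_half_le_sqrt_exp {δ : ℝ} (hδ : 0 < δ) (h : √(Real.exp (2 * δ ^ 2) - 1) < 1) :
    δ + δ ^ 2 / 2 ≤ √(Real.exp (2 * δ ^ 2) - 1) := by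
  have h1 := Real.add_one_le_exp (2 * δ ^ 2)
  have h2 : Real.exp (2 * δ ^ 2) - 1 < 1 := by
    have := (Real.sqrt_lt' one_pos).1 h
    linarith
  have h3 : δ < 3 / 4 := by nlinarith
  refine Real.le_sqrt_of_sq_le ?_
  nlinarith [pow_pos hδ 2, pow_pos hδ 3]

/-- A lower bound for the expected length of an interval that covers two values at distance
`t` with probabilities at least `1 - α` and `1 - α - ε`. -/
theorem ofReal_mul_le_lintegral_length {Ω : Type*} [MeasurableSpace Ω] (μ : Measure Ω)
    [IsProbabilityMeasure μ] {l u : Ω → ℝ} (hl : Measurable l) (hu : Measurable u)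
    {a b α ε t : ℝ} (ht : 0 ≤ t) (hab : b = a + t)
    (ha : ENNReal.ofReal (1 - α) ≤ μ {z | l z ≤ a ∧ a ≤ u z})
    (hb : ENNReal.ofReal (1 - α) ≤ μ {z | l z ≤ b ∧ b ≤ u z} + ENNReal.ofReal ε)
    (hε : 0 ≤ ε) :
    ENNReal.ofReal (t * (1 - 2 * α - ε)) ≤ ∫⁻ z, ENNReal.ofReal (u z - l z) ∂μ := by
  set A := {z | l z ≤ a ∧ a ≤ u z}
  set B := {z | l z ≤ b ∧ b ≤ u z}
  have hA : MeasurableSet A :=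
    (measurableSet_le hl measurable_const).inter (measurableSet_le measurable_const hu)
  have hB : MeasurableSet B :=
    (measurableSet_le hl measurable_const).inter (measurableSet_le measurable_const hu)
  have hA' : 1 - α ≤ μ.real A := (ENNReal.ofReal_le_iff_le_toReal (measure_ne_top _ _)).1 ha
  have hB' : 1 - α ≤ μ.real B + ε := by
    have := (ENNReal.ofReal_le_iff_le_toReal (by finiteness)).1 hb
    rwa [ENNReal.toReal_add (measure_ne_top _ _) ENNReal.ofReal_ne_top,
      ENNReal.toReal_ofReal hε] at this
  have hAB : 1 - 2 * α - ε ≤ μ.real (A ∩ B) := by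
    have h1 := measureReal_union_add_inter (μ := μ) (s := A) hB
    have h2 : μ.real (A ∪ B) ≤ 1 := measureReal_le_one
    linarith
  calc ENNReal.ofReal (t * (1 - 2 * α - ε)) ≤ ENNReal.ofReal (t * μ.real (A ∩ B)) := by gcongr
    _ = ENNReal.ofReal t * μ (A ∩ B) := by
        rw [ENNReal.ofReal_mul ht, ofReal_measureReal]
    _ = ∫⁻ _ in A ∩ B, ENNReal.ofReal t ∂μ := (setLIntegral_const _ _).symm
    _ ≤ ∫⁻ z in A ∩ B, ENNReal.ofReal (u z - l z) ∂μ := by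
        refine setLIntegral_mono' (hA.inter hB) fun z hz => ENNReal.ofReal_le_ofReal ?_
        have h1 := hz.1.1
        have h2 := hz.2.2
        linarith
    _ ≤ _ := setLIntegral_le_lintegral _ _

end ConeCI


theorem mainTheorem9 {n p k : ℕ} (hn : 1 ≤ n)
    (S : Matrix (Fin p) (Fin p) ℝ) (hS : S.PosSemidef) (hS0 : S ≠ 0)
    (σ : ℝ) (hσ : 0 < σ) (α : ℝ) (hα0 : 0 < α) (hα1 : α < 1) (δ : ℝ) (hδ : 0 < δ)
    (w : Fin k → ConeCI.Vec p) (hw : ∀ i, ‖w i‖ = 1)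
    (wbar : ConeCI.Vec p → ℝ)
    (hwbar : ConeCI.IsComplexityBound (ConeCI.coneGeneratedBy w) wbar)
    (R : ℝ) (j : Fin k)
    (βstar : ConeCI.Vec p)
    (hβ : βstar ∈ ConeCI.paramSpace (ConeCI.coneGeneratedBy w) wbar n R) :
    ENNReal.ofReal (δ * (1 - 2 * α - √(Real.exp (2 * δ ^ 2) - 1)) *
        (σ * (ConeCI.sqrtOpNorm S)⁻¹ / √(n : ℝ))) ≤
      ⨅ c ∈ ConeCI.confidenceIntervals n S σ α (w j)
          (ConeCI.paramSpace (ConeCI.coneGeneratedBy w) wbar n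
            (2 * R + 2 * (δ ^ 2 * σ ^ 2 * (ConeCI.sqrtOpNorm S)⁻¹ ^ 2 / √(n : ℝ)))),
        ConeCI.expectedLength n S σ βstar c := by
  set L := ConeCI.sqrtOpNorm S with hLdef
  have hL : 0 < L := ConeCI.sqrtOpNorm_pos hS hS0
  have hs : 0 < √(n : ℝ) := Real.sqrt_pos.2 (by exact_mod_cast hn)
  have hs2 : √(n : ℝ) ^ 2 = n := Real.sq_sqrt (Nat.cast_nonneg n)
  -- This `t` satisfies both `n (L t)² = δ² σ²` and `t² = r / √n`, so the signal-to-noise budget and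
  -- the distance budget are met exactly.
  set t : ℝ := δ * (σ * L⁻¹ / √(n : ℝ)) with ht
  have ht0 : 0 < t := by positivity
  set q : ℝ := √(Real.exp (2 * δ ^ 2) - 1) with hq
  set r : ℝ := δ ^ 2 * σ ^ 2 * L⁻¹ ^ 2 / √(n : ℝ) with hr
  have hr0 : 0 ≤ r := by positivity
  have htr : t ^ 2 = r / √(n : ℝ) := by
    rw [ht, hr]
    field_simp
  refine le_iInf₂ fun c hc => ?_
  obtain ⟨hl, hu, hcov⟩ := hc
  rw [show δ * (1 - 2 * α - q) * (σ * L⁻¹ / √(n : ℝ)) = t * (1 - 2 * α - q) by rw [ht]; ring]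
  rcases le_or_gt 1 q with h1 | h1
  · rw [ENNReal.ofReal_of_nonpos (mul_nonpos_of_nonneg_of_nonpos ht0.le (by linarith))]
    exact zero_le
  have hnorm : ‖t • w j‖ = t := by rw [norm_smul, hw j, mul_one, Real.norm_of_nonneg ht0.le]
  have hmem0 : βstar ∈ ConeCI.paramSpace (ConeCI.coneGeneratedBy w) wbar n (2 * R + 2 * r) := by
    have := ConeCI.mem_paramSpace_of_dist hn hr0 hβ (d := 0) (by simpa using hβ.1)
      (by rw [norm_zero, zero_pow two_ne_zero]; positivity)
    simpa using this
  have hmem1 : βstar + t • w j ∈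
      ConeCI.paramSpace (ConeCI.coneGeneratedBy w) wbar n (2 * R + 2 * r) :=
    ConeCI.mem_paramSpace_of_dist hn hr0 hβ
      (ConeCI.add_smul_mem_coneGeneratedBy hβ.1 j ht0.le) (by rw [hnorm, htr])
  have hcov0 := hcov.trans (iInf₂_le βstar hmem0)
  have hcov1 := hcov.trans (iInf₂_le (βstar + t • w j) hmem1)
  have hq1 : δ + δ ^ 2 / 2 ≤ q := ConeCI.add_sq_half_le_sqrt_exp hδ h1
  have hd : n * (L * ‖t • w j‖) ^ 2 ≤ δ ^ 2 * σ ^ 2 := by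
    rw [hnorm, ← hs2, ht]
    apply le_of_eq
    field_simp
  have htv := ConeCI.dataLaw_add_le S hσ βstar (t • w j) hδ hd
    (A := {z | c.1 z ≤ inner ℝ (w j) (βstar + t • w j) ∧
      inner ℝ (w j) (βstar + t • w j) ≤ c.2 z})
    ((measurableSet_le hl measurable_const).inter (measurableSet_le measurable_const hu))
  refine ConeCI.ofReal_mul_le_lintegral_length _ hl hu ht0.le ?_ hcov0
    (hcov1.trans (htv.trans (by gcongr))) (Real.sqrt_nonneg _)
  rw [inner_add_right, real_inner_smul_right, real_inner_self_eq_norm_sq, hw j]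
  ring
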